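/- Let $\mathbb F_q$ be a finite field with $q$ elements, let $G$ be a commutative algebraic group over $\mathbb F_q$ (a commutative group scheme of finite type over $\mathbb F_q$), and let $F : G \to G$ be the $q$-power Frobenius endomorphism (the identity on the underlying space and $s \mapsto s^q$ on functions). Let $L$ be any field extension of $\mathbb F_q$; then $F$ induces an endomorphism, again denoted $F$, of the abelian group $G(L)$. Let $\Gamma \le G(L)$ be a finitely generated subgroup with $F(\Gamma) \subseteq \Gamma$. Then there is an integer $r > 0$ such that $\Gamma$ has an $F^r$-spanning set. Here, for an abelian group $\Gamma$ with an endomorphism $\phi$, a finite subset $\Sigma \subseteq \Gamma$ is called a $\phi$-spanning set if: (i) $0 \in \Sigma$, and $x \in \Sigma$ implies $-x \in \Sigma$; (ii) for all $x \in \Gamma$, $\phi x \in \Sigma$ implies $x \in \Sigma$; (iii) for every $x \in \Gamma$ there are $m \ge 0$ and $x_0, \dots, x_m \in \Sigma$ with $x = x_0 + \phi x_1 + \cdots + \phi^m x_m$; (iv) for all $x_1, \dots, x_5 \in \Sigma$ there are $t, t' \in \Sigma$ with $x_1 + \cdots + x_5 = t + \phi t'$; (v) if $x_1, x_2, x_3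 \in \Sigma$ and $x_1 + x_2 + x_3 \in \phi(\Gamma)$, then there is $t \in \Sigma$ with $x_1 + x_2 + x_3 = \phi t$. -/

import Mathlib

open CategoryTheory AlgebraicGeometry MonObj

universe u

/-! ### Spanning sets -/

/-- `S` is a `φ`-spanning set for the abelian group `A` with endomorphism `φ`. -/
structure IsSpanningSet {A : Type*} [AddCommGroup A] (φ : AddMonoid.End A) (S : Finset A) :
    Prop where
  zero_mem : (0 : A) ∈ S
  neg_mem : ∀ x ∈ S, -x ∈ S
  mem_of_map_mem : ∀ x : A, φ x ∈ S → x ∈ S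
  exists_expansion : ∀ x : A, ∃ (m : ℕ) (a : Fin (m + 1) → A),
    (∀ i, a i ∈ S) ∧ x = ∑ i : Fin (m + 1), (φ ^ (i : ℕ)) (a i)
  carry : ∀ x₁ ∈ S, ∀ x₂ ∈ S, ∀ x₃ ∈ S, ∀ x₄ ∈ S, ∀ x₅ ∈ S,
    ∃ t ∈ S, ∃ t' ∈ S, x₁ + x₂ + x₃ + x₄ + x₅ = t + φ t'
  divide : ∀ x₁ ∈ S, ∀ x₂ ∈ S, ∀ x₃ ∈ S, (∃ y : A, x₁ + x₂ + x₃ = φ y) →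
    ∃ t ∈ S, x₁ + x₂ + x₃ = φ t

/-! ### The Frobenius endomorphism of a scheme over a finite field -/

namespace FrobeniusScheme

/-- The map `x ↦ x ^ #k` on a commutative ring `R` receiving a ring homomorphism from the finite
field `k`. -/
def powHom {k R : Type*} [Field k] [Fintype k] [CommRing R] (f : k →+* R) : R →+* R :=
  letI := f.toAlgebra
  (FiniteField.frobeniusAlgHom k R).toRingHom

theorem powHom_apply {k R : Type*} [Field k] [Fintype k] [CommRing R] (f : k →+* R) (x : R) :
    powHom f x = x ^ Fintype.card k := rfl

variable {k : Type u} [Field k] [Fintype k]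

/-- The `k`-algebra structure on the sections of a `k`-scheme over an open set. -/
noncomputable def scalars (X : Over (Spec (.of k))) (U : X.left.Opens) :
    k →+* (X.left.presheaf.obj (Opposite.op U) : CommRingCat.{u}) :=
  ((Scheme.ΓSpecIso (.of k)).inv ≫ Scheme.Hom.appTop X.hom ≫
    X.left.presheaf.map (homOfLE (le_top : U ≤ ⊤)).op).hom

/-- The `#k`-power Frobenius of a `k`-scheme `X`, as a morphism of schemes: the identity on the
underlying space and `s ↦ s ^ #k` on sections. -/
noncomputable def absolute (X : Over (Spec (.of k))) : X.left ⟶ X.left :=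
  Scheme.Hom.mk
    { base := 𝟙 _
      c :=
        { app := fun U => CommRingCat.ofHom (powHom (scalars X U.unop))
          naturality := fun U V i => by
            ext x
            exact (map_pow (X.left.presheaf.map i).hom x (Fintype.card k)).symm }
      prop := fun x => by
        refine ⟨fun a ha => ?_⟩
        obtain ⟨U, hx, s, rfl⟩ := X.left.presheaf.exists_germ_eq a
        rw [PresheafedSpace.stalkMap_germ_apply] at ha
        change IsUnit (X.left.presheaf.germ U x hx (s ^ Fintype.card k)) at ha
        rw [map_pow] at ha
        exact (isUnit_pow_iff Fintype.card_ne_zero).mp ha }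

theorem absolute_base (X : Over (Spec (.of k))) : (absolute X).base = 𝟙 _ := rfl

theorem absolute_app (X : Over (Spec (.of k))) (U : X.left.Opens)
    (s : X.left.presheaf.obj (Opposite.op U)) :
    (absolute X).app U s = s ^ Fintype.card k := rfl

theorem absolute_naturality {X Y : Over (Spec (.of k))} (f : X ⟶ Y) :
    absolute X ≫ f.left = f.left ≫ absolute Y := by
  refine Scheme.Hom.ext rfl fun U => ?_
  refine (congrArg (fun m => (absolute X ≫ f.left).app U ≫ m)
    (X.left.presheaf.map_id _)).trans ((Category.comp_id _).trans ?_)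
  ext s
  exact (map_pow (f.left.app U).hom s (Fintype.card k)).symm

theorem absolute_hom (X : Over (Spec (.of k))) : absolute X ≫ X.hom = X.hom := by
  refine ext_of_isAffine ?_
  ext s
  have hs : s ^ Fintype.card k = s := by
    apply (Scheme.ΓSpecIso (.of k)).commRingCatIsoToRingEquiv.injective
    rw [map_pow]
    exact FiniteField.pow_card (K := k) _
  change (X.hom.appTop s) ^ Fintype.card k = X.hom.appTop s
  rw [← map_pow, hs]

/-- The `#k`-power Frobenius endomorphism of a `k`-scheme, as a morphism of `k`-schemes. -/
noncomputable def frobenius (X : Over (Spec (.of k))) : X ⟶ X :=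
  Over.homMk (absolute X) (absolute_hom X)

theorem frobenius_naturality {X Y : Over (Spec (.of k))} (f : X ⟶ Y) :
    frobenius X ≫ f = f ≫ frobenius Y :=
  Over.OverMorphism.ext (absolute_naturality f)

/-- The `L`-rational points `G(L)` of a commutative group scheme over `k`, written additively. -/
abbrev Points (G : Over (Spec (.of k))) (L : Type u) [Field L] [Algebra k L] : Type u :=
  Additive (Over.mk (Spec.map (CommRingCat.ofHom (algebraMap k L))) ⟶ G)

/-- The endomorphism of the group `G(L)` induced by the Frobenius endomorphism `G ⟶ G`. -/
noncomputable def pointsFrobenius (G : Over (Spec (.of k))) [GrpObj G] [IsCommMonObj G]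
    (L : Type u) [Field L] [Algebra k L] : AddMonoid.End (Points G L) :=
  AddMonoidHom.mk' (fun x => Additive.ofMul (x.toMul ≫ frobenius G)) fun x y => by
    simp only [← frobenius_naturality, toMul_add, MonObj.comp_mul]
    rfl

/-- The restriction of an endomorphism of an abelian group to an invariant subgroup. -/
def restrictEnd {A : Type*} [AddCommGroup A] (φ : AddMonoid.End A) (Γ : AddSubgroup A)
    (h : ∀ x ∈ Γ, φ x ∈ Γ) : AddMonoid.End Γ :=
  (AddMonoidHom.comp φ Γ.subtype).codRestrict Γ fun x => h x x.2

end FrobeniusScheme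

/-! Everything rests on a height on Γ (`IsGroupHeight`): balls are finite, addition enlarges heights
at most linearly with a fixed constant, and some power of Frobenius enlarges them by any prescribed
factor M, up to an additive error. As M is chosen after the constant for addition, a power ψ of
Frobenius outweighs the few additions in the carry conditions, and a large enough ball is a
ψ-spanning set. Heights are bounded on ker ψ, so ker ψ and then Γ/ψΓ are finite; subtracting a coset
representative of bounded height and dividing by ψ lowers large heights, and expansions follow by
descent.

To build the height, replace L by a finitely generated field K over which Γ is defined. K is finite
separable over a rational function field over the finite field, where the degree of a reduced
fraction is multiplied by n under n-th powers; summing over coordinates in a basis extends this to K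
(`exists_isFieldHeight`). A point of G(K) gets the least total height of its coordinates over the
charts of a finite affine atlas. The group law is locally given by fractions in the coordinates,
which yields the bound for addition (`exists_pointHeight_mul_le`); Frobenius raises coordinates to
q-th powers, which yields expansion (`exists_mul_pointHeight_le`). Only linear bounds with
unspecified constants matter, so no projective embedding or canonical height is needed. -/

/-! ### Heights on abelian groups -/

/-- The cokernel of an endomorphism with finite kernel of a finitely generated abelian group is
finite. -/
theorem AddMonoid.End.finite_quotient_range {A : Type*} [AddCommGroup A] [Module.Finite ℤ A]
    (ψ : AddMonoid.End A) (hker : {x : A | ψ x = 0}.Finite) :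
    Finite (A ⧸ LinearMap.range (AddMonoidHom.toIntLinearMap ψ)) := by
  set f := AddMonoidHom.toIntLinearMap ψ with hf
  have : Finite (LinearMap.ker f) := hker
  have h0 : Module.finrank ℤ (LinearMap.ker f) = 0 := by
    rw [Module.finrank_eq_zero_iff_isTorsion]
    intro x
    have := isOfFinAddOrder_of_finite x
    refine ⟨⟨addOrderOf x, mem_nonZeroDivisors_of_ne_zero
      (by exact_mod_cast this.addOrderOf_pos.ne')⟩, ?_⟩
    change ((addOrderOf x : ℕ) : ℤ) • x = 0
    rw [natCast_zsmul, addOrderOf_nsmul_eq_zero]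
  -- The kernel has rank 0, so the image has full rank and the cokernel is torsion.
  have h1 := Submodule.finrank_quotient_add_finrank (LinearMap.ker f)
  rw [f.quotKerEquivRange.finrank_eq] at h1
  have h2 := Submodule.finrank_quotient_add_finrank (LinearMap.range f)
  have h3 : Module.finrank ℤ (A ⧸ LinearMap.range f) = 0 := by omega
  rw [Module.finrank_eq_zero_iff_isTorsion] at h3
  exact Module.finite_of_fg_torsion _ h3

/-- A height on an abelian group with respect to an endomorphism. -/
structure IsGroupHeight {A : Type*} [AddCommGroup A] (φ : AddMonoid.End A) (h : A → ℕ) :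
    Prop where
  finite_le : ∀ n, {x | h x ≤ n}.Finite
  add_le : ∃ C : ℕ, ∀ x y, h (x + y) ≤ C * (h x + h y + 1)
  le_map : ∀ M : ℕ, ∃ r : ℕ, 0 < r ∧ ∃ D : ℕ, ∀ x, M * h x ≤ h ((φ ^ r) x) + D

namespace IsGroupHeight

variable {A : Type*} [AddCommGroup A] {φ : AddMonoid.End A} {h : A → ℕ}

/-- The axioms say nothing about negation, but a spanning set must be symmetric and the descent
subtracts representatives. -/
theorem symmetrize (H : IsGroupHeight φ h) : IsGroupHeight φ fun x => max (h x) (h (-x)) where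
  finite_le n := (H.finite_le n).subset fun x (hx : max _ _ ≤ n) => (le_max_left _ _).trans hx
  add_le := by
    obtain ⟨C, hC⟩ := H.add_le
    refine ⟨C, fun x y => max_le ((hC x y).trans ?_) ?_⟩
    · gcongr <;> exact le_max_left _ _
    · rw [neg_add]
      refine (hC _ _).trans ?_
      gcongr <;> exact le_max_right _ _
  le_map M := by
    obtain ⟨r, hr, D, hD⟩ := H.le_map M
    refine ⟨r, hr, D, fun x => ?_⟩
    rw [← Nat.mul_max_mul_left]
    refine max_le ((hD x).trans (by gcongr; exact le_max_left _ _)) ((hD _).trans ?_)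
    rw [map_neg]
    gcongr
    exact le_max_right _ _

/-- The spanning set is a ball of radius R. Each addition costs a factor 4C beyond radius R, and
dividing by ψ gains more than five such factors. -/
theorem exists_isSpanningSet_of_neg [Module.Finite ℤ A] (H : IsGroupHeight φ h)
    (hneg : ∀ x, h (-x) = h x) :
    ∃ r : ℕ, 0 < r ∧ ∃ S : Finset A, IsSpanningSet (φ ^ r) S := by
  obtain ⟨C₀, hC₀⟩ := H.add_le
  obtain ⟨C, hC1, hC⟩ : ∃ C : ℕ, 1 ≤ C ∧ ∀ x y, h (x + y) ≤ C * (h x + h y + 1) :=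
    ⟨C₀ + 1, by omega, fun x y => (hC₀ x y).trans (by gcongr; omega)⟩
  -- The exponent 5 counts the additions in x₁ + ⋯ + x₅ - t; the factor 6 leaves room to absorb D.
  obtain ⟨r, hr, D, hD⟩ := H.le_map (6 * (4 * C) ^ 5)
  refine ⟨r, hr, ?_⟩
  generalize φ ^ r = ψ at hD
  set M := (4 * C) ^ 5 with hM
  have hCM : 4 * C ≤ M := Nat.le_self_pow (by norm_num) _
  have hfin := ψ.finite_quotient_range <| (H.finite_le (h 0 + D)).subset fun x (hx : ψ x = 0) => by
    have := hD x
    rw [hx] at this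
    refine le_trans ?_ this
    exact Nat.le_mul_of_pos_left _ (by omega)
  obtain ⟨B, hB⟩ : ∃ B, ∀ x, ∃ t, h t ≤ B ∧ ∃ y, x = t + ψ y := by
    have := Fintype.ofFinite (A ⧸ LinearMap.range (AddMonoidHom.toIntLinearMap ψ))
    refine ⟨∑ c : A ⧸ LinearMap.range (AddMonoidHom.toIntLinearMap ψ), h c.out, fun x => ?_⟩
    refine ⟨(Submodule.Quotient.mk (p := LinearMap.range (AddMonoidHom.toIntLinearMap ψ)) x).out,
      Finset.single_le_sum (f := fun c => h (Quotient.out c)) (fun _ _ => Nat.zero_le _)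
        (Finset.mem_univ _), ?_⟩
    have : (Submodule.Quotient.mk (p := LinearMap.range (AddMonoidHom.toIntLinearMap ψ)) x) =
      Submodule.Quotient.mk (Quotient.out (Submodule.Quotient.mk x)) :=
        (Quotient.out_eq _).symm
    rw [Submodule.Quotient.eq] at this
    obtain ⟨y, hy⟩ := this
    exact ⟨y, by rw [← sub_eq_iff_eq_add']; exact hy.symm⟩
  -- The bound B + 1 rather than B forces R ≥ 1, which turns the linear bound for addition into the
  -- purely multiplicative `hadd`.
  obtain ⟨R, hR0, hRB, hRD⟩ : ∃ R, h 0 ≤ R ∧ B + 1 ≤ R ∧ D ≤ R :=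
    ⟨h 0 + (B + 1) + D, by omega, by omega, by omega⟩
  have hadd (x y : A) (n : ℕ) (hn : R ≤ n) (hx : h x ≤ n) (hy : h y ≤ n) :
      h (x + y) ≤ 4 * C * n := by
    refine (hC x y).trans ?_
    rw [mul_comm 4 C, _root_.mul_assoc]
    gcongr
    omega
  have hpow (i : ℕ) : R ≤ (4 * C) ^ i * R := Nat.le_mul_of_pos_left _ (by positivity)
  have hstep (i : ℕ) (x y : A) (hx : h x ≤ (4 * C) ^ i * R) (hy : h y ≤ R) :
      h (x + y) ≤ (4 * C) ^ (i + 1) * R := by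
    refine (hadd x y _ (hpow i) hx (hy.trans (hpow i))).trans_eq ?_
    ring
  have hsmall (y : A) (i : ℕ) (hi : i ≤ 5) (hy : h (ψ y) ≤ (4 * C) ^ i * R) : h y ≤ R := by
    have h1 : (4 * C) ^ i * R ≤ M * R := by
      gcongr ?_ * R
      exact Nat.pow_le_pow_right (by omega) hi
    have h2 := hD y
    have hMpos : 0 < M := by positivity
    by_contra! hlt
    have h3 : M * R < M * h y := by gcongr
    have h4 : R ≤ M * R := Nat.le_mul_of_pos_left _ hMpos
    rw [_root_.mul_assoc] at h2
    omega
  refine ⟨(H.finite_le R).toFinset, ⟨?_, ?_, ?_, ?_, ?_, ?_⟩⟩ <;>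
    simp only [Set.Finite.mem_toFinset, Set.mem_ofPred_eq]
  · exact hR0
  · exact fun x hx => (hneg x).trans_le hx
  · exact fun x hx => hsmall x 0 (by norm_num) (by simpa using hx)
  · intro x
    induction hn : h x using Nat.strong_induction_on generalizing x with
    | _ n ih =>
    subst hn
    by_cases hx : h x ≤ R
    · exact ⟨0, fun _ => x, fun _ => hx, by simp⟩
    · obtain ⟨t, ht, y, hy⟩ := hB x
      have hy1 : h (ψ y) ≤ 4 * C * h x := by
        have : ψ y = x + -t := by rw [hy]; abel
        rw [this]
        exact hadd _ _ _ (by omega) le_rfl (by rw [hneg]; omega)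
      -- Outside the ball D < h x, so the additive error cannot spoil the descent.
      have hlt : h y < h x := by
        have h2 := hD y
        by_contra! hle
        have h3 : 4 * C * h x ≤ M * h y := by gcongr
        have h4 : h y ≤ M * h y := Nat.le_mul_of_pos_left _ (by positivity)
        rw [_root_.mul_assoc] at h2
        omega
      obtain ⟨m, a, ha, hya⟩ := ih _ hlt y rfl
      refine ⟨m + 1, Fin.cons t a, fun i => ?_, ?_⟩
      · refine Fin.cases ?_ (fun i => ?_) i
        · simp only [Fin.cons_zero]; omega
        · simpa using ha i
      · rw [Fin.sum_univ_succ, hy, hya, map_sum]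
        simp only [Fin.cons_zero, Fin.cons_succ, Fin.val_zero, Fin.val_succ, pow_zero, pow_succ']
        rfl
  · intro x₁ h₁ x₂ h₂ x₃ h₃ x₄ h₄ x₅ h₅
    obtain ⟨t, ht, y, hy⟩ := hB (x₁ + x₂ + x₃ + x₄ + x₅)
    refine ⟨t, by omega, y, hsmall y 5 le_rfl ?_, hy⟩
    have : ψ y = x₁ + x₂ + x₃ + x₄ + x₅ + -t := by rw [hy]; abel
    rw [this]
    have h0 : h x₁ ≤ (4 * C) ^ 0 * R := by simpa using h₁
    exact hstep _ _ _ (hstep _ _ _ (hstep _ _ _ (hstep _ _ _ (hstep _ _ _ h0 h₂) h₃) h₄) h₅)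
      (by rw [hneg]; omega)
  · rintro x₁ h₁ x₂ h₂ x₃ h₃ ⟨y, hy⟩
    refine ⟨y, hsmall y 2 (by norm_num) ?_, hy⟩
    rw [← hy]
    have h0 : h x₁ ≤ (4 * C) ^ 0 * R := by simpa using h₁
    exact hstep _ _ _ (hstep _ _ _ h0 h₂) h₃

/-- An endomorphism of a finitely generated abelian group admitting a height has a power with a
spanning set. -/
theorem exists_isSpanningSet [Module.Finite ℤ A] (H : IsGroupHeight φ h) :
    ∃ r : ℕ, 0 < r ∧ ∃ S : Finset A, IsSpanningSet (φ ^ r) S :=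
  H.symmetrize.exists_isSpanningSet_of_neg fun x => by simp [max_comm]

end IsGroupHeight

/-! ### Heights on fields -/

/-- A height on a field, for which raising to the powers `q ^ r` is expanding. -/
structure IsFieldHeight (q : ℕ) {K : Type*} [Field K] (H : K → ℕ) : Prop where
  finite_le : ∀ n, {a | H a ≤ n}.Finite
  add_le : ∃ C : ℕ, ∀ a b, H (a + b) ≤ C * (H a + H b + 1)
  mul_le : ∃ C : ℕ, ∀ a b, H (a * b) ≤ C * (H a + H b + 1)
  inv_le : ∃ C : ℕ, ∀ a, H a⁻¹ ≤ C * (H a + 1)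
  le_pow : ∀ M : ℕ, ∃ r : ℕ, 0 < r ∧ ∃ D : ℕ, ∀ a, M * H a ≤ H (a ^ q ^ r) + D

/-! ### Degrees of rational functions -/

namespace RationalHeight

open MvPolynomial

variable {σ k : Type*} [Field k] {E : Type*} [Field E] [Algebra (MvPolynomial σ k) E]
  [IsFractionRing (MvPolynomial σ k) E]

local notation "num'" => IsFractionRing.num (MvPolynomial σ k)
local notation "den'" => IsFractionRing.den (MvPolynomial σ k)

variable (σ k) in
/-- The degree of a rational function: the larger of the total degrees of the numerator and
denominator in lowest terms. -/
noncomputable def height (x : E) : ℕ :=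
  max (totalDegree (num' x)) (totalDegree (den' x : MvPolynomial σ k))

/-- Hence any representation as a fraction, reduced or not, bounds the height from above. -/
theorem dvd_of_eq_div {x : E} {u v : MvPolynomial σ k} (hv : v ≠ 0)
    (h : x = algebraMap _ E u / algebraMap _ E v) :
    num' x ∣ u ∧ (den' x : MvPolynomial σ k) ∣ v := by
  have hinj := IsFractionRing.injective (MvPolynomial σ k) E
  have hd : algebraMap _ E (den' x : MvPolynomial σ k) ≠ 0 :=
    (map_ne_zero_iff _ hinj).2 (nonZeroDivisors.ne_zero (den' x).2)
  have hv' : algebraMap _ E v ≠ 0 := (map_ne_zero_iff _ hinj).2 hv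
  have key : num' x * v = u * den' x := by
    apply hinj
    rw [map_mul, map_mul, ← div_eq_div_iff hd hv', IsFractionRing.mk'_num_den', h]
  have hr := IsFractionRing.num_den_reduced (MvPolynomial σ k) x
  exact ⟨hr.dvd_of_dvd_mul_right ⟨v, key.symm⟩,
    hr.symm.dvd_of_dvd_mul_left ⟨u, by rw [key, mul_comm]⟩⟩

theorem height_le {x : E} {u v : MvPolynomial σ k} {n : ℕ} (hv : v ≠ 0)
    (h : x = algebraMap _ E u / algebraMap _ E v) (hu : u.totalDegree ≤ n)
    (hv' : v.totalDegree ≤ n) : height σ k x ≤ n := by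
  obtain ⟨h1, h2⟩ := dvd_of_eq_div hv h
  refine max_le ?_ ((totalDegree_le_of_dvd_of_isDomain h2 hv).trans hv')
  rcases eq_or_ne u 0 with rfl | hu0
  · have : x = 0 := by simpa using h
    simp [this]
  · exact (totalDegree_le_of_dvd_of_isDomain h1 hu0).trans hu

theorem totalDegree_pow_eq (u : MvPolynomial σ k) (n : ℕ) :
    (u ^ n).totalDegree = n * u.totalDegree := by
  rcases eq_or_ne u 0 with rfl | hu
  · rcases n with _ | n <;> simp
  induction n with
  | zero => simp
  | succ n ih =>
    rw [pow_succ, totalDegree_mul_of_isDomain (pow_ne_zero n hu) hu, ih]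
    ring

/-- Powers of coprime polynomials stay coprime, so no cancellation lowers the degree of the power.
-/
theorem mul_height_le (x : E) {n : ℕ} (hn : n ≠ 0) : n * height σ k x ≤ height σ k (x ^ n) := by
  have hinj := IsFractionRing.injective (MvPolynomial σ k) E
  have hd0 (y : E) : (den' y : MvPolynomial σ k) ≠ 0 := nonZeroDivisors.ne_zero (den' y).2
  have hd (y : E) : algebraMap _ E (den' y : MvPolynomial σ k) ≠ 0 :=
    (map_ne_zero_iff _ hinj).2 (hd0 y)
  have key : num' (x ^ n) * (den' x : MvPolynomial σ k) ^ n = num' x ^ n * den' (x ^ n) := by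
    apply hinj
    rw [map_mul, map_mul, ← div_eq_div_iff (hd _) (by rw [map_pow]; exact pow_ne_zero _ (hd x)),
      IsFractionRing.mk'_num_den', map_pow, map_pow, ← div_pow, IsFractionRing.mk'_num_den']
  have hr : IsRelPrime (num' x ^ n) ((den' x : MvPolynomial σ k) ^ n) :=
    (IsFractionRing.num_den_reduced (MvPolynomial σ k) x).pow
  have h1 : num' x ^ n ∣ num' (x ^ n) := hr.dvd_of_dvd_mul_right ⟨_, key⟩
  have h2 : (den' x : MvPolynomial σ k) ^ n ∣ den' (x ^ n) :=
    hr.symm.dvd_of_dvd_mul_left ⟨num' (x ^ n), by rw [← key, mul_comm]⟩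
  rw [height, height, ← Nat.mul_max_mul_left, ← totalDegree_pow_eq, ← totalDegree_pow_eq]
  refine max_le_max ?_ (totalDegree_le_of_dvd_of_isDomain h2 (hd0 _))
  rcases eq_or_ne x 0 with rfl | hx
  · simp [hn]
  · refine totalDegree_le_of_dvd_of_isDomain h1 ?_
    rw [Ne, IsFractionRing.num_eq_zero]
    exact pow_ne_zero _ hx

theorem finite_totalDegree_le [Finite σ] [Finite k] (n : ℕ) :
    {p : MvPolynomial σ k | p.totalDegree ≤ n}.Finite := by
  have : Finite (restrictTotalDegree σ k n) := Module.finite_of_finite k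
  refine (Set.toFinite (restrictTotalDegree σ k n : Set (MvPolynomial σ k))).subset fun p hp => ?_
  exact (mem_restrictTotalDegree _ _ _).2 hp

variable (σ k) in
theorem exists_eq_div (x : E) : ∃ u v : MvPolynomial σ k, v ≠ 0 ∧
    x = algebraMap _ E u / algebraMap _ E v ∧ u.totalDegree ≤ height σ k x ∧
      v.totalDegree ≤ height σ k x :=
  ⟨num' x, den' x, nonZeroDivisors.ne_zero (den' x).2, (IsFractionRing.mk'_num_den' _ _).symm,
    le_max_left _ _, le_max_right _ _⟩

theorem isFieldHeight [Finite σ] [Finite k] {q : ℕ} (hq : 1 < q) :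
    IsFieldHeight q (height σ k : E → ℕ) := by
  have hinj := IsFractionRing.injective (MvPolynomial σ k) E
  have hne {v : MvPolynomial σ k} (hv : v ≠ 0) : algebraMap _ E v ≠ 0 :=
    (map_ne_zero_iff _ hinj).2 hv
  have hm {u v : MvPolynomial σ k} {a b c : ℕ} (hu : u.totalDegree ≤ a) (hv : v.totalDegree ≤ b)
      (hab : a + b ≤ c) : (u * v).totalDegree ≤ c :=
    (totalDegree_mul u v).trans ((add_le_add hu hv).trans hab)
  refine ⟨fun n => ?_, ⟨1, fun a b => ?_⟩, ⟨1, fun a b => ?_⟩, ⟨1, fun a => ?_⟩, fun M => ?_⟩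
  · refine (((finite_totalDegree_le (σ := σ) (k := k) n).prod
      (finite_totalDegree_le (σ := σ) (k := k) n)).image
      fun p => algebraMap _ E p.1 / algebraMap _ E p.2).subset fun x (hx : height σ k x ≤ n) => ?_
    obtain ⟨u, v, -, hx', hu, hv⟩ := exists_eq_div σ k x
    exact ⟨(u, v), ⟨hu.trans hx, hv.trans hx⟩, hx'.symm⟩
  · obtain ⟨u, v, hv0, ha, hu, hv⟩ := exists_eq_div σ k a
    obtain ⟨s, t, ht0, hb, hs, ht⟩ := exists_eq_div σ k b
    refine height_le (u := u * t + v * s) (v := v * t) (mul_ne_zero hv0 ht0) ?_ ?_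
      (hm hv ht (by omega))
    · rw [map_add, map_mul, map_mul, map_mul, ← div_add_div _ _ (hne hv0) (hne ht0), ← ha, ← hb]
    · exact (totalDegree_add _ _).trans (max_le (hm hu ht (by omega)) (hm hv hs (by omega)))
  · obtain ⟨u, v, hv0, ha, hu, hv⟩ := exists_eq_div σ k a
    obtain ⟨s, t, ht0, hb, hs, ht⟩ := exists_eq_div σ k b
    refine height_le (u := u * s) (v := v * t) (mul_ne_zero hv0 ht0) ?_ (hm hu hs (by omega))
      (hm hv ht (by omega))
    rw [map_mul, map_mul, mul_div_mul_comm, ← ha, ← hb]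
  · rcases eq_or_ne a 0 with rfl | ha0
    · rw [inv_zero]; omega
    · obtain ⟨u, v, hv0, ha, hu, hv⟩ := exists_eq_div σ k a
      refine height_le (u := v) (v := u) (fun h => ha0 (by simp [ha, h])) ?_
        (hv.trans (by omega)) (hu.trans (by omega))
      rw [← inv_div, ← ha]
  -- Here M ≤ q ^ (M + 1) since q > 1; the shift by one keeps the exponent positive when M = 0.
  · refine ⟨M + 1, by omega, 0, fun a => ?_⟩
    refine le_trans ?_ (mul_height_le a (pow_ne_zero _ (by omega)))
    gcongr
    exact (Nat.le_succ M).trans (Nat.lt_pow_self hq).le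

end RationalHeight

/-- `g` is bounded by a linear function of `h`. -/
def LinearlyBounded {T : Type*} (h g : T → ℕ) : Prop :=
  ∃ C : ℕ, ∀ t, g t ≤ C * (h t + 1)

namespace LinearlyBounded

variable {T : Type*} {h g g' : T → ℕ}

theorem mono (hg : LinearlyBounded h g) (hle : ∀ t, g' t ≤ g t) : LinearlyBounded h g' :=
  let ⟨C, hC⟩ := hg
  ⟨C, fun t => (hle t).trans (hC t)⟩

theorem of_le (hle : ∀ t, g t ≤ h t) : LinearlyBounded h g :=
  ⟨1, fun t => by have := hle t; omega⟩

theorem const (n : ℕ) : LinearlyBounded h fun _ => n :=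
  ⟨n, fun _ => Nat.le_mul_of_pos_right _ (Nat.succ_pos _)⟩

theorem add (hg : LinearlyBounded h g) (hg' : LinearlyBounded h g') :
    LinearlyBounded h fun t => g t + g' t :=
  let ⟨C, hC⟩ := hg
  let ⟨C', hC'⟩ := hg'
  ⟨C + C', fun t => by rw [add_mul]; exact add_le_add (hC t) (hC' t)⟩

theorem const_mul (hg : LinearlyBounded h g) (c : ℕ) : LinearlyBounded h fun t => c * g t :=
  let ⟨C, hC⟩ := hg
  ⟨c * C, fun t => by rw [_root_.mul_assoc]; exact Nat.mul_le_mul_left _ (hC t)⟩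

theorem sum {J : Type*} {s : Finset J} {g : J → T → ℕ} (hg : ∀ i ∈ s, LinearlyBounded h (g i)) :
    LinearlyBounded h fun t => ∑ i ∈ s, g i t := by
  induction s using Finset.cons_induction with
  | empty => simpa using const 0
  | cons i s hi ih =>
    simp only [Finset.sum_cons]
    exact (hg i (by simp)).add (ih fun j hj => hg j (by simp [hj]))

theorem trans (hg : LinearlyBounded h g) (hg' : LinearlyBounded g g') : LinearlyBounded h g' :=
  let ⟨C', hC'⟩ := hg'
  ((hg.add (const 1)).const_mul C').mono hC'

theorem precomp (hg : LinearlyBounded h g) {U : Type*} (f : U → T) :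
    LinearlyBounded (fun u => h (f u)) fun u => g (f u) :=
  let ⟨C, hC⟩ := hg
  ⟨C, fun t => hC (f t)⟩

end LinearlyBounded

/-! ### Linear bounds for field operations, and finite separable extensions -/

namespace IsFieldHeight

variable {q : ℕ} {K : Type*} [Field K] {H : K → ℕ} {T : Type*} {h : T → ℕ}

theorem comp_ringEquiv (hH : IsFieldHeight q H) {K' : Type*} [Field K'] (e : K' ≃+* K) :
    IsFieldHeight q fun a => H (e a) where
  finite_le n := (hH.finite_le n).preimage e.injective.injOn
  add_le := hH.add_le.imp fun C hC a b => by rw [map_add]; exact hC _ _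
  mul_le := hH.mul_le.imp fun C hC a b => by rw [map_mul]; exact hC _ _
  inv_le := hH.inv_le.imp fun C hC a => by rw [map_inv₀]; exact hC _
  le_pow M := (hH.le_pow M).imp fun r hr => ⟨hr.1, hr.2.imp fun D hD a => by
    rw [map_pow]; exact hD _⟩

section Bounded

variable {f g : T → K}

theorem bounded_add (hH : IsFieldHeight q H) (hf : LinearlyBounded h fun t => H (f t))
    (hg : LinearlyBounded h fun t => H (g t)) : LinearlyBounded h fun t => H (f t + g t) :=
  let ⟨C, hC⟩ := hH.add_le
  (((hf.add hg).add (.const 1)).const_mul C).mono fun _ => hC _ _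

theorem bounded_mul (hH : IsFieldHeight q H) (hf : LinearlyBounded h fun t => H (f t))
    (hg : LinearlyBounded h fun t => H (g t)) : LinearlyBounded h fun t => H (f t * g t) :=
  let ⟨C, hC⟩ := hH.mul_le
  (((hf.add hg).add (.const 1)).const_mul C).mono fun _ => hC _ _

theorem bounded_inv (hH : IsFieldHeight q H) (hf : LinearlyBounded h fun t => H (f t)) :
    LinearlyBounded h fun t => H (f t)⁻¹ :=
  let ⟨C, hC⟩ := hH.inv_le
  ((hf.add (.const 1)).const_mul C).mono fun _ => hC _

theorem bounded_sum (hH : IsFieldHeight q H) {J : Type*} {s : Finset J} {f : J → T → K}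
    (hf : ∀ i ∈ s, LinearlyBounded h fun t => H (f i t)) :
    LinearlyBounded h fun t => H (∑ i ∈ s, f i t) := by
  induction s using Finset.cons_induction with
  | empty => simpa using .const _
  | cons i s hi ih =>
    simp only [Finset.sum_cons]
    exact hH.bounded_add (hf i (by simp)) (ih fun j hj => hf j (by simp [hj]))

theorem bounded_prod (hH : IsFieldHeight q H) {J : Type*} {s : Finset J} {f : J → T → K}
    (hf : ∀ i ∈ s, LinearlyBounded h fun t => H (f i t)) :
    LinearlyBounded h fun t => H (∏ i ∈ s, f i t) := by
  induction s using Finset.cons_induction with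
  | empty => simpa using .const _
  | cons i s hi ih =>
    simp only [Finset.prod_cons]
    exact hH.bounded_mul (hf i (by simp)) (ih fun j hj => hf j (by simp [hj]))

theorem bounded_det (hH : IsFieldHeight q H) {J : Type*} [Fintype J] [DecidableEq J]
    {f : T → Matrix J J K} (hf : ∀ i j, LinearlyBounded h fun t => H (f t i j)) :
    LinearlyBounded h fun t => H (f t).det := by
  simp only [Matrix.det_apply']
  exact hH.bounded_sum fun σ _ => hH.bounded_mul (.const _) (hH.bounded_prod fun i _ => hf _ _)

/-- Cramer's rule; singular matrices are covered because their inverse is 0 by convention, in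
agreement with 0⁻¹ = 0 for the determinant. -/
theorem bounded_matrix_inv (hH : IsFieldHeight q H) {J : Type*} [Fintype J] [DecidableEq J]
    {f : T → Matrix J J K} (hf : ∀ i j, LinearlyBounded h fun t => H (f t i j)) (i j : J) :
    LinearlyBounded h fun t => H ((f t)⁻¹ i j) := by
  simp only [Matrix.inv_def, Matrix.smul_apply, smul_eq_mul, Ring.inverse_eq_inv',
    Matrix.adjugate_apply]
  refine hH.bounded_mul (hH.bounded_inv (hH.bounded_det hf)) (hH.bounded_det fun a b => ?_)
  simp only [Matrix.updateRow_apply]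
  split
  · exact .const _
  · exact hf a b

end Bounded

section Extension

open Module

variable {E : Type*} [Field E] [Algebra K E] {J : Type*} [Fintype J]

/-- The sum of the heights of the coordinates in a basis. -/
noncomputable def basisHeight (H : K → ℕ) (b : Basis J K E) (a : E) : ℕ :=
  ∑ i, H (b.repr a i)

theorem repr_le_basisHeight (b : Basis J K E) (a : E) (i : J) :
    H (b.repr a i) ≤ basisHeight H b a :=
  Finset.single_le_sum (f := fun i => H (b.repr a i)) (fun _ _ => Nat.zero_le _)
    (Finset.mem_univ i)

theorem bounded_repr {b : Basis J K E} {f : T → E}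
    (hf : LinearlyBounded h fun t => basisHeight H b (f t)) (i : J) :
    LinearlyBounded h fun t => H (b.repr (f t) i) :=
  hf.mono fun _ => repr_le_basisHeight b _ i

theorem bounded_leftMulMatrix (hH : IsFieldHeight q H) [DecidableEq J] {b : Basis J K E}
    {f : T → E} (hf : LinearlyBounded h fun t => basisHeight H b (f t)) (i j : J) :
    LinearlyBounded h fun t => H (Algebra.leftMulMatrix b (f t) i j) := by
  have (a : E) : Algebra.leftMulMatrix b a i j =
      ∑ l, b.repr a l * Algebra.leftMulMatrix b (b l) i j := by
    have := congrArg (fun x => Algebra.leftMulMatrix b x i j) (b.sum_repr a).symm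
    simpa only [map_sum, map_smul, Matrix.sum_apply, Matrix.smul_apply, smul_eq_mul] using this
  refine LinearlyBounded.mono ?_ fun t => (congrArg H (this (f t))).le
  exact hH.bounded_sum fun l _ => hH.bounded_mul (bounded_repr hf l) (.const _)

theorem bounded_basisHeight_mul (hH : IsFieldHeight q H) {b : Basis J K E} {f g : T → E}
    (hf : LinearlyBounded h fun t => basisHeight H b (f t))
    (hg : LinearlyBounded h fun t => basisHeight H b (g t)) :
    LinearlyBounded h fun t => basisHeight H b (f t * g t) := by
  classical
  refine LinearlyBounded.sum fun i _ => ?_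
  simp only [← Algebra.leftMulMatrix_mulVec_repr, Matrix.mulVec, dotProduct]
  exact hH.bounded_sum fun j _ => hH.bounded_mul (hH.bounded_leftMulMatrix hf i j)
    (bounded_repr hg j)

/-- The coordinates of a⁻¹ are obtained by applying the inverse of the matrix of multiplication by a
to those of 1. -/
theorem bounded_basisHeight_inv (hH : IsFieldHeight q H) {b : Basis J K E} {f : T → E}
    (hf : LinearlyBounded h fun t => basisHeight H b (f t)) :
    LinearlyBounded h fun t => basisHeight H b (f t)⁻¹ := by
  classical
  have : Nonempty J := b.index_nonempty
  have hinv (a : E) : Algebra.leftMulMatrix b a⁻¹ = (Algebra.leftMulMatrix b a)⁻¹ := by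
    rcases eq_or_ne a 0 with rfl | ha
    · simp
    · refine (Matrix.inv_eq_left_inv ?_).symm
      rw [← map_mul, inv_mul_cancel₀ ha, map_one]
  refine LinearlyBounded.sum fun i _ => ?_
  have (a : E) : b.repr a⁻¹ i = ∑ j, (Algebra.leftMulMatrix b a)⁻¹ i j * b.repr 1 j := by
    rw [← hinv]
    conv_lhs => rw [← _root_.mul_one a⁻¹, ← Algebra.leftMulMatrix_mulVec_repr]
    rfl
  simp only [this]
  exact hH.bounded_sum fun j _ => hH.bounded_mul
    (hH.bounded_matrix_inv (hH.bounded_leftMulMatrix hf) i j) (.const _)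

/-- By separability the powers `b i ^ q ^ r` again form a basis, in which the coordinates of `a ^ q
^ r` are the q ^ r-th powers of those of `a`. Returning to `b` costs the factor C, which does not
depend on r; the change-of-basis matrix does, but it enters only the additive constant. -/
theorem basisHeight_le_pow (hH : IsFieldHeight q H) {p m : ℕ} [ExpChar K p] (hq : q = p ^ m)
    [Algebra.IsSeparable K E] (b : Basis J K E) (M : ℕ) :
    ∃ r : ℕ, 0 < r ∧ ∃ D : ℕ, ∀ a, M * basisHeight H b a ≤ basisHeight H b (a ^ q ^ r) + D := by
  obtain ⟨C, hC⟩ : LinearlyBounded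
      (fun t : (J → K) × (J → K) => ∑ j, H (t.1 j) + ∑ j, H (t.2 j))
      fun t => H (∑ j, t.1 j * t.2 j) := by
    refine hH.bounded_sum fun j _ => hH.bounded_mul (.of_le fun t => ?_) (.of_le fun t => ?_)
    · exact (Finset.single_le_sum (f := fun j => H (t.1 j)) (fun _ _ => Nat.zero_le _)
        (Finset.mem_univ j)).trans (Nat.le_add_right _ _)
    · exact (Finset.single_le_sum (f := fun j => H (t.2 j)) (fun _ _ => Nat.zero_le _)
        (Finset.mem_univ j)).trans (Nat.le_add_left _ _)
  -- The factor lost in the change of basis, summed over coordinates; the exponent r is chosen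
  -- afterwards to make up for it.
  set N := Fintype.card J * C + 1 with hN
  obtain ⟨r, hr, D, hD⟩ := hH.le_pow (N * M)
  have : ExpChar E p := expChar_of_injective_algebraMap (algebraMap K E).injective p
  have hpow : q ^ r = p ^ (m * r) := by rw [hq, pow_mul]
  let b' := b.mapPowExpCharPowOfIsSeparable p (m * r)
  have hb' (i : J) : b' i = b i ^ p ^ (m * r) := by
    simp [b', Basis.mapPowExpCharPowOfIsSeparable]
  have hrepr (a : E) (i : J) : b'.repr (a ^ q ^ r) i = b.repr a i ^ q ^ r := by
    have : a ^ q ^ r = ∑ i, (b.repr a i ^ q ^ r) • b' i := by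
      conv_lhs => rw [← b.sum_repr a, hpow, ← iterateFrobenius_def, map_sum]
      simp only [hb', iterateFrobenius_def, smul_pow, hpow]
    rw [this, b'.repr_sum_self]
  have hchange (c : E) (i : J) : b'.repr c i = ∑ j, b.repr c j * b'.repr (b j) i := by
    have := congrArg (fun x => b'.repr x i) (b.sum_repr c).symm
    simpa only [map_sum, map_smul, Finsupp.finsetSum_apply, Finsupp.smul_apply, smul_eq_mul]
      using this
  refine ⟨r, hr, ∑ i, (C * (∑ j, H (b'.repr (b j) i) + 1) + D), fun a => ?_⟩
  have key (i : J) : N * M * H (b.repr a i) ≤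
      C * basisHeight H b (a ^ q ^ r) + (C * (∑ j, H (b'.repr (b j) i) + 1) + D) := by
    refine (hD _).trans ?_
    rw [← hrepr, hchange, ← add_assoc, ← mul_add, ← add_assoc]
    exact Nat.add_le_add_right (hC (b.repr (a ^ q ^ r), fun j => b'.repr (b j) i)) _
  have hsum := Finset.sum_le_sum fun i (_ : i ∈ Finset.univ) => key i
  rw [← Finset.mul_sum, Finset.sum_add_distrib, Finset.sum_const, Finset.card_univ, smul_eq_mul,
    ← _root_.mul_assoc] at hsum
  have hNpos : 0 < N := Nat.succ_pos _
  refine Nat.le_of_mul_le_mul_left ?_ hNpos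
  rw [← _root_.mul_assoc, mul_add]
  refine hsum.trans (add_le_add ?_ (Nat.le_mul_of_pos_left _ hNpos))
  gcongr
  exact Nat.le_succ _

theorem bounded_basisHeight_add (hH : IsFieldHeight q H) {b : Basis J K E} {f g : T → E}
    (hf : LinearlyBounded h fun t => basisHeight H b (f t))
    (hg : LinearlyBounded h fun t => basisHeight H b (g t)) :
    LinearlyBounded h fun t => basisHeight H b (f t + g t) := by
  refine LinearlyBounded.sum fun i _ => ?_
  simp only [map_add, Finsupp.add_apply]
  exact hH.bounded_add (bounded_repr hf i) (bounded_repr hg i)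

theorem isFieldHeight_basisHeight (hH : IsFieldHeight q H) {p m : ℕ} [ExpChar K p]
    (hq : q = p ^ m) [Algebra.IsSeparable K E] (b : Basis J K E) :
    IsFieldHeight q (basisHeight H b) where
  finite_le n := by
    refine ((Set.Finite.pi' fun _ : J => hH.finite_le n).preimage
      b.equivFun.injective.injOn).subset fun a ha i => ?_
    exact (repr_le_basisHeight b a i).trans ha
  add_le := by
    obtain ⟨C, hC⟩ := hH.bounded_basisHeight_add (b := b) (f := Prod.fst) (g := Prod.snd)
      (h := fun t : E × E => basisHeight H b t.1 + basisHeight H b t.2)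
      (.of_le fun t => Nat.le_add_right _ _) (.of_le fun t => Nat.le_add_left _ _)
    exact ⟨C, fun x y => hC (x, y)⟩
  mul_le := by
    obtain ⟨C, hC⟩ := hH.bounded_basisHeight_mul (b := b) (f := Prod.fst) (g := Prod.snd)
      (h := fun t : E × E => basisHeight H b t.1 + basisHeight H b t.2)
      (.of_le fun t => Nat.le_add_right _ _) (.of_le fun t => Nat.le_add_left _ _)
    exact ⟨C, fun x y => hC (x, y)⟩
  inv_le := hH.bounded_basisHeight_inv (b := b) (h := basisHeight H b) (f := fun t => t)
    (.of_le fun _ => le_rfl)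
  le_pow := hH.basisHeight_le_pow hq b

end Extension

end IsFieldHeight

/-- A finitely generated extension of a finite field has a height. -/
theorem exists_isFieldHeight (k K : Type*) [Field k] [Fintype k] [Field K] [Algebra k K]
    [Algebra.EssFiniteType k K] : ∃ H : K → ℕ, IsFieldHeight (Fintype.card k) H := by
  -- A finite field is perfect, so a separating transcendence basis exists.
  obtain ⟨s, hs, hsep⟩ := exists_isTranscendenceBasis_and_isSeparable_of_perfectField k K
  obtain ⟨p, m, hp, hcard⟩ : ∃ p m : ℕ, ExpChar k p ∧ Fintype.card k = p ^ m := by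
    obtain ⟨p, hp⟩ := CharP.exists k
    obtain ⟨m, hprime, hm⟩ := FiniteField.card k p
    have := Fact.mk hprime
    exact ⟨p, m, inferInstance, hm⟩
  have h₀ := RationalHeight.isFieldHeight (σ := s) (k := k)
    (E := FractionRing (MvPolynomial s k)) (Fintype.one_lt_card (α := k))
  have hrange : IntermediateField.adjoin k (Set.range ((↑) : s → K)) =
      IntermediateField.adjoin k (s : Set K) := by simp
  have h₁ := h₀.comp_ringEquiv ((hs.1.aevalEquivField.trans
    (IntermediateField.equivOfEq hrange)).symm.toRingEquiv)
  have : Algebra.EssFiniteType (IntermediateField.adjoin k (s : Set K)) K :=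
    Algebra.EssFiniteType.of_comp k _ K
  have : FiniteDimensional (IntermediateField.adjoin k (s : Set K)) K :=
    Algebra.finite_of_essFiniteType_of_isAlgebraic
  have : ExpChar (IntermediateField.adjoin k (s : Set K)) p :=
    expChar_of_injective_algebraMap (algebraMap k _).injective p
  exact ⟨_, h₁.isFieldHeight_basisHeight hcard (Module.finBasis _ K)⟩

/-! ### Affine charts -/

namespace FrobeniusScheme

variable {k : Type u} [Field k]

variable (k) in
/-- The spectrum of a `k`-algebra as a `k`-scheme. -/
noncomputable abbrev specOver (A : Type u) [CommRing A] [Algebra k A] : Over (Spec (.of k)) :=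
  Over.mk (Spec.map (CommRingCat.ofHom (algebraMap k A)))

section SpecHom

variable {A B C : Type u} [CommRing A] [Algebra k A] [CommRing B] [Algebra k B] [CommRing C]
  [Algebra k C]

/-- The morphism of `k`-schemes induced by a homomorphism of `k`-algebras. -/
noncomputable def specHom (f : A →ₐ[k] B) : specOver k B ⟶ specOver k A :=
  Over.homMk (Spec.map (CommRingCat.ofHom f.toRingHom)) <| by
    dsimp only [Over.mk_hom]
    rw [← Spec.map_comp, ← CommRingCat.ofHom_comp, AlgHom.toRingHom_eq_coe, AlgHom.comp_algebraMap]

theorem specHom_comp (g : B →ₐ[k] C) (f : A →ₐ[k] B) :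
    specHom (g.comp f) = specHom g ≫ specHom f := by
  apply Over.OverMorphism.ext
  change Spec.map _ = Spec.map _ ≫ Spec.map _
  rw [← Spec.map_comp]
  rfl

theorem specHom_id : specHom (AlgHom.id k A) = 𝟙 (specOver k A) := by
  apply Over.OverMorphism.ext
  exact Spec.map_id _

theorem specHom_injective : Function.Injective (specHom : (A →ₐ[k] B) → _) := fun f g h => by
  have : Spec.map (CommRingCat.ofHom f.toRingHom) = Spec.map (CommRingCat.ofHom g.toRingHom) :=
    congrArg CommaMorphism.left h
  have := congrArg CommRingCat.Hom.hom (Spec.map_injective this)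
  exact AlgHom.ext fun x => congrArg (fun φ : A →+* B => φ x) this

theorem specHom_surjective : Function.Surjective (specHom : (A →ₐ[k] B) → _) := fun g => by
  have hw : Spec.map (CommRingCat.ofHom (algebraMap k A) ≫ Spec.preimage g.left) =
      Spec.map (CommRingCat.ofHom (algebraMap k B)) := by
    rw [Spec.map_comp, Spec.map_preimage]
    exact Over.w g
  have hw' := Spec.map_injective hw
  refine ⟨{ (Spec.preimage g.left).hom with
    commutes' := fun r => congrArg (fun φ => φ.hom r) hw' }, ?_⟩
  apply Over.OverMorphism.ext
  exact Spec.map_preimage g.left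

end SpecHom

/-- A finite cover of a `k`-scheme by spectra of finitely generated `k`-algebras. -/
structure AffineAtlas (G : Over (Spec (.of k))) where
  /-- The index set. -/
  index : Type u
  /-- The index set is finite. -/
  fintype : Fintype index
  /-- The coordinate rings of the charts. -/
  alg : index → CommAlgCat.{u} k
  finiteType : ∀ j, Algebra.FiniteType k (alg j)
  /-- The charts. -/
  chart : ∀ j, specOver k (alg j) ⟶ G
  isOpenImmersion : ∀ j, IsOpenImmersion (chart j).left
  exists_mem_range : ∀ x : G.left, ∃ j, x ∈ Set.range (chart j).left

theorem nonempty_affineAtlas (G : Over (Spec (.of k))) [LocallyOfFiniteType G.hom]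
    [QuasiCompact G.hom] : Nonempty (AffineAtlas G) := by
  have : CompactSpace G.left := QuasiCompact.compactSpace_of_compactSpace G.hom
  let c := G.left.affineOpenCover
  obtain ⟨t, ht⟩ := CompactSpace.elim_nhds_subcover (fun x : G.left => Set.range (c.f (c.idx x)))
    fun x => (IsOpenImmersion.isOpen_range (c.f (c.idx x))).mem_nhds (c.covers x)
  let φ (x : G.left) : CommRingCat.of k ⟶ c.X (c.idx x) := Spec.preimage (c.f (c.idx x) ≫ G.hom)
  refine ⟨⟨t, inferInstance, fun x => @CommAlgCat.of k _ (c.X (c.idx x.1)) _ (φ x).hom.toAlgebra,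
    fun x => ?_, fun x => Over.homMk (c.f (c.idx x.1)) (Spec.map_preimage _).symm,
    fun x => ?_, fun x => ?_⟩⟩
  · change (φ x).hom.FiniteType
    rw [← HasRingHomProperty.Spec_iff (P := @LocallyOfFiniteType), Spec.map_preimage]
    infer_instance
  · change IsOpenImmersion (c.f (c.idx x.1))
    infer_instance
  · have hx : x ∈ (⊤ : Set G.left) := trivial
    rw [← ht] at hx
    obtain ⟨y, hy, hxy⟩ := Set.mem_iUnion₂.1 hx
    exact ⟨⟨y, hy⟩, hxy⟩

namespace AffineAtlas

variable {G : Over (Spec (.of k))} (𝒜 : AffineAtlas G)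

instance : Fintype 𝒜.index := 𝒜.fintype

instance (j : 𝒜.index) : Algebra.FiniteType k (𝒜.alg j) := 𝒜.finiteType j

instance (j : 𝒜.index) : IsOpenImmersion (𝒜.chart j).left := 𝒜.isOpenImmersion j

/-- Generators of the coordinate ring of a chart. -/
noncomputable def gens (j : 𝒜.index) : Finset (𝒜.alg j) := (𝒜.finiteType j).out.choose

theorem adjoin_gens (j : 𝒜.index) : Algebra.adjoin k (𝒜.gens j : Set (𝒜.alg j)) = ⊤ :=
  (𝒜.finiteType j).out.choose_spec

theorem algHom_ext {j : 𝒜.index} {B : Type*} [CommRing B] [Algebra k B] {f g : 𝒜.alg j →ₐ[k] B}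
    (h : ∀ a ∈ 𝒜.gens j, f a = g a) : f = g :=
  AlgHom.ext_of_adjoin_eq_top (𝒜.adjoin_gens j) h

theorem exists_eq_specHom_comp {B : Type u} [CommRing B] [Algebra k B] (g : specOver k B ⟶ G)
    (j : 𝒜.index) (h : Set.range g.left ⊆ Set.range (𝒜.chart j).left) :
    ∃ f : 𝒜.alg j →ₐ[k] B, g = specHom f ≫ 𝒜.chart j := by
  let l : specOver k B ⟶ specOver k (𝒜.alg j) :=
    Over.homMk (IsOpenImmersion.lift (𝒜.chart j).left g.left h) <| by
      rw [← Over.w (𝒜.chart j), IsOpenImmersion.lift_fac_assoc, Over.w]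
  obtain ⟨f, hf⟩ := specHom_surjective l
  refine ⟨f, ?_⟩
  rw [hf]
  apply Over.OverMorphism.ext
  exact (IsOpenImmersion.lift_fac _ _ h).symm

theorem specHom_comp_chart_injective {B : Type u} [CommRing B] [Algebra k B] {j : 𝒜.index}
    {f g : 𝒜.alg j →ₐ[k] B} (h : specHom f ≫ 𝒜.chart j = specHom g ≫ 𝒜.chart j) : f = g := by
  apply specHom_injective
  apply Over.OverMorphism.ext
  rw [← cancel_mono (𝒜.chart j).left]
  exact congrArg CommaMorphism.left h

section FieldPoints

variable {K : Type u} [Field K] [Algebra k K]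

/-- The spectrum of a field is a single point, so its image lies in a chart as soon as that point
does. -/
theorem exists_chart_comp_of_mem_range (x : specOver k K ⟶ G) {j : 𝒜.index}
    {p : (specOver k K).left} (h : x.left p ∈ Set.range (𝒜.chart j).left) :
    ∃ f : 𝒜.alg j →ₐ[k] K, x = specHom f ≫ 𝒜.chart j := by
  refine 𝒜.exists_eq_specHom_comp x j ?_
  rintro _ ⟨p', rfl⟩
  have : Subsingleton (specOver k K).left :=
    inferInstanceAs (Subsingleton (PrimeSpectrum K))
  rwa [Subsingleton.elim p' p]

theorem exists_chart_comp (x : specOver k K ⟶ G) :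
    ∃ (j : 𝒜.index) (f : 𝒜.alg j →ₐ[k] K), x = specHom f ≫ 𝒜.chart j := by
  obtain ⟨p⟩ : Nonempty (specOver k K).left := inferInstanceAs (Nonempty (PrimeSpectrum K))
  obtain ⟨j, hj⟩ := 𝒜.exists_mem_range (x.left p)
  exact ⟨j, 𝒜.exists_chart_comp_of_mem_range x hj⟩

/-- A point whose composite with an extension of fields lies in a chart lies in that chart. -/
theorem exists_chart_comp_of_specHom_comp {L : Type u} [Field L] [Algebra k L]
    (e : K →ₐ[k] L) (x : specOver k K ⟶ G) {j : 𝒜.index} {f : 𝒜.alg j →ₐ[k] L}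
    (h : specHom e ≫ x = specHom f ≫ 𝒜.chart j) :
    ∃ g : 𝒜.alg j →ₐ[k] K, x = specHom g ≫ 𝒜.chart j ∧ f = e.comp g := by
  obtain ⟨p⟩ : Nonempty (specOver k L).left := inferInstanceAs (Nonempty (PrimeSpectrum L))
  have hp : x.left ((specHom e).left p) = (𝒜.chart j).left ((specHom f).left p) := by
    have := congrArg (fun y : specOver k L ⟶ G => y.left p) h
    simpa using this
  obtain ⟨g, hg⟩ := 𝒜.exists_chart_comp_of_mem_range x (j := j) (p := (specHom e).left p)
    ⟨_, hp.symm⟩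
  refine ⟨g, hg, 𝒜.specHom_comp_chart_injective ?_⟩
  rw [← h, hg, specHom_comp, Category.assoc]

end FieldPoints

/-- A morphism from an affine scheme is, locally on basic open sets, given by charts. -/
theorem exists_away {B : Type u} [CommRing B] [Algebra k B] (g : specOver k B ⟶ G) :
    ∃ S : Finset B, Ideal.span (S : Set B) = ⊤ ∧ ∀ s ∈ S, ∃ (j : 𝒜.index)
      (f : 𝒜.alg j →ₐ[k] Localization.Away s),
        specHom (Algebra.algHom k B (Localization.Away s)) ≫ g = specHom f ≫ 𝒜.chart j := by
  let T : Set B := {s | ∃ (j : 𝒜.index) (f : 𝒜.alg j →ₐ[k] Localization.Away s),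
    specHom (Algebra.algHom k B (Localization.Away s)) ≫ g = specHom f ≫ 𝒜.chart j}
  have hT : Ideal.span T = ⊤ := by
    -- Otherwise `T` lies in a maximal ideal; a basic open neighbourhood of that point inside the
    -- preimage of a chart yields an element of `T` outside the ideal.
    by_contra hne
    obtain ⟨m, hm, hle⟩ := Ideal.exists_le_maximal _ hne
    let p : PrimeSpectrum B := ⟨m, hm.isPrime⟩
    obtain ⟨j, hj⟩ := 𝒜.exists_mem_range (g.left p)
    have hopen : IsOpen (g.left ⁻¹' Set.range (𝒜.chart j).left) :=
      (IsOpenImmersion.isOpen_range (𝒜.chart j).left).preimage g.left.continuous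
    obtain ⟨_, ⟨s, rfl⟩, hps, hsub⟩ :=
      PrimeSpectrum.isTopologicalBasis_basic_opens.exists_subset_of_mem_open hj hopen
    refine hps (hle (Ideal.subset_span ⟨j, 𝒜.exists_eq_specHom_comp _ j ?_⟩))
    rintro _ ⟨y, rfl⟩
    refine hsub ?_
    have : PrimeSpectrum.comap (algebraMap B (Localization.Away s)) y ∈
        Set.range (PrimeSpectrum.comap (algebraMap B (Localization.Away s))) := ⟨y, rfl⟩
    rwa [PrimeSpectrum.localization_away_comap_range (Localization.Away s) s] at this
  obtain ⟨S, hST, hS⟩ := (Ideal.span_eq_top_iff_finite T).1 hT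
  exact ⟨S, hS, fun s hs => hST hs⟩

end AffineAtlas

end FrobeniusScheme

/-! ### Heights of points -/

namespace FrobeniusScheme

namespace AffineAtlas

variable {k : Type u} [Field k] {G : Over (Spec (.of k))} (𝒜 : AffineAtlas G)
variable {K : Type u} [Field K] [Algebra k K] (H : K → ℕ)

/-- The sum of the heights of the coordinates of a point in a chart. -/
noncomputable def coordHeight (j : 𝒜.index) (f : 𝒜.alg j →ₐ[k] K) : ℕ :=
  ∑ a ∈ 𝒜.gens j, H (f a)

/-- The least height of the coordinates of a point in a chart containing it. -/
noncomputable def pointHeight (x : specOver k K ⟶ G) : ℕ :=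
  sInf {n | ∃ (j : 𝒜.index) (f : 𝒜.alg j →ₐ[k] K),
    x = specHom f ≫ 𝒜.chart j ∧ 𝒜.coordHeight H j f = n}

theorem pointHeight_le (j : 𝒜.index) (f : 𝒜.alg j →ₐ[k] K) :
    𝒜.pointHeight H (specHom f ≫ 𝒜.chart j) ≤ 𝒜.coordHeight H j f :=
  Nat.sInf_le ⟨j, f, rfl, rfl⟩

theorem exists_pointHeight_eq (x : specOver k K ⟶ G) :
    ∃ (j : 𝒜.index) (f : 𝒜.alg j →ₐ[k] K),
      x = specHom f ≫ 𝒜.chart j ∧ 𝒜.coordHeight H j f = 𝒜.pointHeight H x := by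
  obtain ⟨j, f, hf⟩ := 𝒜.exists_chart_comp x
  exact Nat.sInf_mem (s := {n | ∃ (j : 𝒜.index) (f : 𝒜.alg j →ₐ[k] K),
    x = specHom f ≫ 𝒜.chart j ∧ 𝒜.coordHeight H j f = n}) ⟨_, j, f, hf, rfl⟩

theorem le_coordHeight {j : 𝒜.index} (f : 𝒜.alg j →ₐ[k] K) {a : 𝒜.alg j} (ha : a ∈ 𝒜.gens j) :
    H (f a) ≤ 𝒜.coordHeight H j f :=
  Finset.single_le_sum (f := fun a => H (f a)) (fun _ _ => Nat.zero_le _) ha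

variable {H} {q : ℕ}

theorem bounded_apply (hH : IsFieldHeight q H) (j : 𝒜.index) (a : 𝒜.alg j) :
    LinearlyBounded (𝒜.coordHeight H j) fun f => H (f a) := by
  have ha : a ∈ Algebra.adjoin k (𝒜.gens j : Set (𝒜.alg j)) := by
    rw [𝒜.adjoin_gens]; trivial
  induction ha using Algebra.adjoin_induction with
  | mem a ha => exact .of_le fun f => 𝒜.le_coordHeight H f ha
  | algebraMap r => simpa using .const _
  | add a b _ _ iha ihb => simpa using hH.bounded_add iha ihb
  | mul a b _ _ iha ihb => simpa using hH.bounded_mul iha ihb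

theorem finite_pointHeight_le (hH : IsFieldHeight q H) (n : ℕ) :
    {x : specOver k K ⟶ G | 𝒜.pointHeight H x ≤ n}.Finite := by
  have hfin (j : 𝒜.index) : {f : 𝒜.alg j →ₐ[k] K | 𝒜.coordHeight H j f ≤ n}.Finite := by
    have hinj : Function.Injective fun (f : 𝒜.alg j →ₐ[k] K) (a : 𝒜.gens j) => f a :=
      fun f g h => 𝒜.algHom_ext fun a ha => congrFun h ⟨a, ha⟩
    refine ((Set.Finite.pi' fun _ : 𝒜.gens j => hH.finite_le n).preimage
      hinj.injOn).subset fun f hf a => ?_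
    exact (𝒜.le_coordHeight H f a.2).trans hf
  refine (Set.finite_iUnion fun j => (hfin j).image fun f => specHom f ≫ 𝒜.chart j).subset
    fun x hx => ?_
  obtain ⟨j, f, rfl, hf⟩ := 𝒜.exists_pointHeight_eq H x
  exact Set.mem_iUnion.2 ⟨j, f, hf.trans_le hx, rfl⟩

/-- Composition of points of bounded height on an affine scheme with a fixed morphism. -/
theorem bounded_pointHeight_comp (hH : IsFieldHeight q H) {B : Type u} [CommRing B] [Algebra k B]
    (g : specOver k B ⟶ G) {T : Type*} {h : T → ℕ} (F : T → B →ₐ[k] K)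
    (hF : ∀ b, LinearlyBounded h fun t => H (F t b)) :
    LinearlyBounded h fun t => 𝒜.pointHeight H (specHom (F t) ≫ g) := by
  classical
  obtain ⟨S, hS, hS'⟩ := 𝒜.exists_away g
  -- Where s does not vanish, the chart coordinates are values of fractions b / s ^ n, with b and n
  -- independent of t.
  have hbound (s : S) : ∃ w : T → ℕ, LinearlyBounded h w ∧ ∀ t, F t s ≠ 0 →
      𝒜.pointHeight H (specHom (F t) ≫ g) ≤ w t := by
    obtain ⟨s, hs⟩ := s
    obtain ⟨j, f, hf⟩ := hS' s hs
    have hfrac (a : 𝒜.alg j) : ∃ (b : B) (n : ℕ), ∀ e : Localization.Away s →ₐ[k] K,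
        e (algebraMap B _ s) ≠ 0 → e (f a) = e (algebraMap B _ b) * (e (algebraMap B _ s) ^ n)⁻¹ := by
      obtain ⟨n, b, hb⟩ := IsLocalization.Away.surj s (f a)
      refine ⟨b, n, fun e he => ?_⟩
      rw [eq_mul_inv_iff_mul_eq₀ (pow_ne_zero _ he), ← hb, map_mul, map_pow]
    choose b n hbn using hfrac
    refine ⟨fun t => ∑ a ∈ 𝒜.gens j, H (F t (b a) * (F t s ^ n a)⁻¹), .sum fun a _ =>
      hH.bounded_mul (hF _) (hH.bounded_inv ?_), fun t ht => ?_⟩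
    · simpa using hF (s ^ n a)
    · have hunit (y : Submonoid.powers s) : IsUnit (F t y) := by
        obtain ⟨_, m, rfl⟩ := y
        simpa using (IsUnit.mk0 _ ht).pow m
      let e : Localization.Away s →ₐ[k] K :=
        IsLocalization.liftAlgHom (M := Submonoid.powers s) (f := F t) hunit
      have he (x : B) : e (algebraMap B _ x) = F t x := IsLocalization.lift_eq hunit x
      have hcomp : F t = e.comp (Algebra.algHom k B (Localization.Away s)) :=
        AlgHom.ext fun x => (he x).symm
      have hpt : specHom (F t) ≫ g = specHom (e.comp f) ≫ 𝒜.chart j := by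
        rw [hcomp, specHom_comp, specHom_comp, Category.assoc, Category.assoc, hf]
      rw [hpt]
      refine (𝒜.pointHeight_le H j _).trans (Finset.sum_le_sum fun a _ => le_of_eq ?_)
      rw [AlgHom.comp_apply, hbn a e (by rwa [he]), he, he]
  choose w hw hw' using hbound
  -- The usable s varies with t, so all the bounds are added; one s works because `S` generates the
  -- unit ideal.
  refine (LinearlyBounded.sum (s := Finset.univ) fun s _ => hw s).mono fun t => ?_
  obtain ⟨s, hs, hst⟩ : ∃ s ∈ S, F t s ≠ 0 := by
    by_contra! hall
    have hle : Ideal.span (S : Set B) ≤ RingHom.ker (F t) := Ideal.span_le.2 hall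
    rw [hS] at hle
    exact one_ne_zero ((map_one (F t)).symm.trans (hle (Submodule.mem_top (x := (1 : B)))))
  exact (hw' ⟨s, hs⟩ t hst).trans
    (Finset.single_le_sum (f := fun s => w s t) (fun _ _ => Nat.zero_le _) (Finset.mem_univ _))

/-- On a product of two charts the group law is a morphism from the spectrum of a tensor product,
and a pair of points is one point there, so `bounded_pointHeight_comp` applies; there are finitely
many pairs of charts. -/
theorem exists_pointHeight_mul_le (hH : IsFieldHeight q H) [GrpObj G] :
    ∃ C : ℕ, ∀ x y : specOver k K ⟶ G,
      𝒜.pointHeight H (x * y) ≤ C * (𝒜.pointHeight H x + 𝒜.pointHeight H y + 1) := by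
  have hij (i j : 𝒜.index) : ∃ C : ℕ, ∀ (f : 𝒜.alg i →ₐ[k] K) (g : 𝒜.alg j →ₐ[k] K),
      𝒜.pointHeight H ((specHom f ≫ 𝒜.chart i) * (specHom g ≫ 𝒜.chart j)) ≤
        C * (𝒜.coordHeight H i f + 𝒜.coordHeight H j g + 1) := by
    let m : specOver k (TensorProduct k (𝒜.alg i) (𝒜.alg j)) ⟶ G :=
      (specHom Algebra.TensorProduct.includeLeft ≫ 𝒜.chart i) *
        (specHom Algebra.TensorProduct.includeRight ≫ 𝒜.chart j)
    let F (t : (𝒜.alg i →ₐ[k] K) × (𝒜.alg j →ₐ[k] K)) :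
        TensorProduct k (𝒜.alg i) (𝒜.alg j) →ₐ[k] K :=
      Algebra.TensorProduct.lift t.1 t.2 fun _ _ => Commute.all _ _
    have hF (t) : specHom (F t) ≫ m =
        (specHom t.1 ≫ 𝒜.chart i) * (specHom t.2 ≫ 𝒜.chart j) := by
      have h₁ : (F t).comp Algebra.TensorProduct.includeLeft = t.1 := AlgHom.ext fun a => by simp [F]
      have h₂ : (F t).comp Algebra.TensorProduct.includeRight = t.2 := AlgHom.ext fun a => by simp [F]
      rw [MonObj.comp_mul, ← Category.assoc, ← Category.assoc, ← specHom_comp, ← specHom_comp,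
        h₁, h₂]
    have hbd := 𝒜.bounded_pointHeight_comp hH m
      (h := fun t => 𝒜.coordHeight H i t.1 + 𝒜.coordHeight H j t.2) F fun b => by
        induction b with
        | zero => simpa using .const _
        | tmul a b =>
          simp only [F, Algebra.TensorProduct.lift_tmul]
          refine hH.bounded_mul ?_ ?_
          · exact (LinearlyBounded.of_le fun t => Nat.le_add_right _ _).trans
              ((𝒜.bounded_apply hH i a).precomp Prod.fst)
          · exact (LinearlyBounded.of_le fun t => Nat.le_add_left _ _).trans
              ((𝒜.bounded_apply hH j b).precomp Prod.snd)
        | add a b iha ihb => simpa using hH.bounded_add iha ihb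
    obtain ⟨C, hC⟩ := hbd
    refine ⟨C, fun f g => ?_⟩
    rw [← hF (f, g)]
    exact hC (f, g)
  choose C hC using hij
  refine ⟨∑ i, ∑ j, C i j, fun x y => ?_⟩
  obtain ⟨i, f, hx, hf⟩ := 𝒜.exists_pointHeight_eq H x
  obtain ⟨j, g, hy, hg⟩ := 𝒜.exists_pointHeight_eq H y
  rw [← hf, ← hg]
  conv_lhs => rw [hx, hy]
  refine (hC i j f g).trans (Nat.mul_le_mul_right _ ?_)
  exact (Finset.single_le_sum (f := fun j => C i j) (fun _ _ => Nat.zero_le _)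
    (Finset.mem_univ j)).trans (Finset.single_le_sum (f := fun i => ∑ j, C i j)
      (fun _ _ => Nat.zero_le _) (Finset.mem_univ i))

/-- The best chart for the image point already contains x, so both heights can be compared in it,
coordinate by coordinate. -/
theorem exists_mul_pointHeight_le (hH : IsFieldHeight q H) (M : ℕ) :
    ∃ r : ℕ, 0 < r ∧ ∃ D : ℕ, ∀ φ : K →ₐ[k] K, (∀ a, φ a = a ^ q ^ r) → ∀ x : specOver k K ⟶ G,
      M * 𝒜.pointHeight H x ≤ 𝒜.pointHeight H (specHom φ ≫ x) + D := by
  obtain ⟨r, hr, D, hD⟩ := hH.le_pow M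
  refine ⟨r, hr, ∑ j, (𝒜.gens j).card * D, fun φ hφ x => ?_⟩
  obtain ⟨j, f, hx, hf⟩ := 𝒜.exists_pointHeight_eq H (specHom φ ≫ x)
  obtain ⟨g, hg, rfl⟩ := 𝒜.exists_chart_comp_of_specHom_comp φ x hx
  calc M * 𝒜.pointHeight H x ≤ M * 𝒜.coordHeight H j g := by
        rw [hg]
        exact Nat.mul_le_mul_left _ (𝒜.pointHeight_le H j g)
    _ ≤ ∑ a ∈ 𝒜.gens j, (H (φ (g a)) + D) := by
        rw [coordHeight, Finset.mul_sum]
        exact Finset.sum_le_sum fun a _ => by rw [hφ]; exact hD _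
    _ = 𝒜.pointHeight H (specHom φ ≫ x) + (𝒜.gens j).card * D := by
        rw [Finset.sum_add_distrib, Finset.sum_const, smul_eq_mul, ← hf]
        rfl
    _ ≤ _ := by
        gcongr
        exact Finset.single_le_sum (f := fun j => (𝒜.gens j).card * D) (fun _ _ => Nat.zero_le _)
          (Finset.mem_univ j)

end AffineAtlas

/-! ### The Frobenius on points -/

section Frobenius

variable {k : Type u} [Field k] [Fintype k]

theorem frobenius_specOver (A : Type u) [CommRing A] [Algebra k A] :
    frobenius (specOver k A) = specHom (FiniteField.frobeniusAlgHom k A) := by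
  apply Over.OverMorphism.ext
  have : IsAffine (specOver k A).left := inferInstanceAs (IsAffine (Spec (.of A)))
  refine ext_of_isAffine ?_
  ext s
  apply (Scheme.ΓSpecIso (.of A)).commRingCatIsoToRingEquiv.injective
  change (Scheme.ΓSpecIso (.of A)).hom (s ^ Fintype.card k) =
    (Scheme.ΓSpecIso (.of A)).hom ((Spec.map (CommRingCat.ofHom
      (FiniteField.frobeniusAlgHom k A).toRingHom)).appTop s)
  rw [map_pow]
  exact (congrArg (fun φ => φ.hom s) (Scheme.ΓSpecIso_naturality (CommRingCat.ofHom
      (FiniteField.frobeniusAlgHom k A).toRingHom))).symm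

variable (G : Over (Spec (.of k))) [GrpObj G] [IsCommMonObj G] (L : Type u) [Field L] [Algebra k L]

/-- Naturality trades the Frobenius of G for that of Spec L, which acts on coordinates by q-th
powers. -/
theorem toMul_pointsFrobenius_pow (r : ℕ) (x : Points G L) :
    ((pointsFrobenius G L ^ r) x).toMul =
      specHom (FiniteField.frobeniusAlgHom k L ^ r) ≫ x.toMul := by
  induction r with
  | zero => exact ((congrArg (· ≫ x.toMul) specHom_id).trans (Category.id_comp _)).symm
  | succ r ih =>
    rw [pow_succ', pow_succ]
    change ((pointsFrobenius G L ^ r) x).toMul ≫ frobenius G =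
      specHom ((FiniteField.frobeniusAlgHom k L ^ r).comp (FiniteField.frobeniusAlgHom k L)) ≫ _
    rw [ih, Category.assoc, ← frobenius_naturality, frobenius_specOver, specHom_comp,
      Category.assoc, ← Category.assoc, ← specHom_comp]

theorem exists_isGroupHeight [LocallyOfFiniteType G.hom] [QuasiCompact G.hom]
    [Algebra.EssFiniteType k L] : ∃ h : Points G L → ℕ, IsGroupHeight (pointsFrobenius G L) h := by
  obtain ⟨𝒜⟩ := nonempty_affineAtlas G
  obtain ⟨H, hH⟩ := exists_isFieldHeight k L
  refine ⟨fun x => 𝒜.pointHeight H x.toMul, 𝒜.finite_pointHeight_le hH,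
    𝒜.exists_pointHeight_mul_le hH, fun M => ?_⟩
  obtain ⟨r, hr, D, hD⟩ := 𝒜.exists_mul_pointHeight_le hH M
  refine ⟨r, hr, D, fun x => ?_⟩
  rw [toMul_pointsFrobenius_pow]
  refine hD _ (fun a => ?_) _
  rw [AlgHom.coe_pow, FiniteField.coe_frobeniusAlgHom, pow_iterate]

end Frobenius

end FrobeniusScheme

/-! ### Descent to a finitely generated field -/

namespace FrobeniusScheme

variable {k : Type u} [Field k]

/-- Two points with the same image lie in a common chart, where injectivity of `e` decides. -/
theorem specHom_comp_injective (G : Over (Spec (.of k))) [LocallyOfFiniteType G.hom]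
    [QuasiCompact G.hom] {K L : Type u} [Field K] [Algebra k K] [Field L] [Algebra k L]
    (e : K →ₐ[k] L) : Function.Injective fun x : specOver k K ⟶ G => specHom e ≫ x := by
  intro x y hxy
  obtain ⟨𝒜⟩ := nonempty_affineAtlas G
  obtain ⟨j, f, rfl⟩ := 𝒜.exists_chart_comp x
  obtain ⟨g, rfl, hg⟩ := 𝒜.exists_chart_comp_of_specHom_comp e y (f := e.comp f) <| by
    rw [specHom_comp, Category.assoc]
    exact hxy.symm
  rw [show f = g from AlgHom.ext fun a => e.injective (DFunLike.congr_fun hg a)]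

/-- It suffices to adjoin the finitely many chart coordinates of the given points. -/
theorem exists_intermediateField_fg (G : Over (Spec (.of k))) [LocallyOfFiniteType G.hom]
    [QuasiCompact G.hom] {L : Type u} [Field L] [Algebra k L] {S : Set (specOver k L ⟶ G)}
    (hS : S.Finite) : ∃ K : IntermediateField k L, K.FG ∧
      ∀ x ∈ S, ∃ y : specOver k K ⟶ G, specHom K.val ≫ y = x := by
  obtain ⟨𝒜⟩ := nonempty_affineAtlas G
  choose j f hf using fun x : specOver k L ⟶ G => 𝒜.exists_chart_comp x
  have hfin : (⋃ x ∈ S, f x '' (𝒜.gens (j x) : Set (𝒜.alg (j x)))).Finite :=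
    hS.biUnion fun x _ => (Finset.finite_toSet _).image _
  refine ⟨IntermediateField.adjoin k _, IntermediateField.fg_adjoin_of_finite hfin,
    fun x hx => ?_⟩
  have hmem (a : 𝒜.alg (j x)) : f x a ∈ IntermediateField.adjoin k
      (⋃ x ∈ S, f x '' (𝒜.gens (j x) : Set (𝒜.alg (j x)))) := by
    have ha : a ∈ Algebra.adjoin k (𝒜.gens (j x) : Set (𝒜.alg (j x))) := by
      rw [𝒜.adjoin_gens]; trivial
    induction ha using Algebra.adjoin_induction with
    | mem a ha => exact IntermediateField.subset_adjoin _ _ (Set.mem_biUnion hx ⟨a, ha, rfl⟩)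
    | algebraMap r => rw [AlgHom.commutes]; exact IntermediateField.algebraMap_mem _ r
    | add a b _ _ iha ihb => rw [map_add]; exact add_mem iha ihb
    | mul a b _ _ iha ihb => rw [map_mul]; exact mul_mem iha ihb
  refine ⟨specHom ((f x).codRestrict (IntermediateField.adjoin k _).toSubalgebra hmem) ≫
    𝒜.chart (j x), ?_⟩
  conv_rhs => rw [hf x]
  rw [← Category.assoc]
  congr 1
  exact (specHom_comp _ _).symm

variable [Fintype k] (G : Over (Spec (.of k))) [GrpObj G] [IsCommMonObj G]

/-- The homomorphism from `G(K)` to `G(L)` induced by a homomorphism of fields. -/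
noncomputable def pointsMap {K L : Type u} [Field K] [Algebra k K] [Field L] [Algebra k L]
    (e : K →ₐ[k] L) : Points G K →+ Points G L :=
  AddMonoidHom.mk' (fun x => Additive.ofMul (specHom e ≫ x.toMul)) fun x y =>
    congrArg Additive.ofMul (MonObj.comp_mul (specHom e) x.toMul y.toMul)

theorem pointsMap_pointsFrobenius {K L : Type u} [Field K] [Algebra k K] [Field L] [Algebra k L]
    (e : K →ₐ[k] L) (x : Points G K) :
    pointsMap G e (pointsFrobenius G K x) = pointsFrobenius G L (pointsMap G e x) :=
  congrArg Additive.ofMul (Category.assoc _ _ _).symm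

theorem pointsMap_pointsFrobenius_pow {K L : Type u} [Field K] [Algebra k K] [Field L]
    [Algebra k L] (e : K →ₐ[k] L) (r : ℕ) (x : Points G K) :
    pointsMap G e ((pointsFrobenius G K ^ r) x) =
      (pointsFrobenius G L ^ r) (pointsMap G e x) := by
  induction r with
  | zero => rfl
  | succ r ih =>
    rw [pow_succ', pow_succ']
    exact (pointsMap_pointsFrobenius G e _).trans (congrArg _ ih)

theorem coe_restrictEnd_pow {A : Type*} [AddCommGroup A] (φ : AddMonoid.End A) (Γ : AddSubgroup A)
    (h : ∀ x ∈ Γ, φ x ∈ Γ) (r : ℕ) (x : Γ) :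
    ((restrictEnd φ Γ h ^ r) x : A) = (φ ^ r) x := by
  induction r with
  | zero => rfl
  | succ r ih =>
    rw [pow_succ', pow_succ']
    exact congrArg φ ih

end FrobeniusScheme

open FrobeniusScheme in
theorem mainTheorem9 {k : Type u} [Field k] [Fintype k]
    (G : Over (Spec (.of k))) [GrpObj G] [IsCommMonObj G]
    [LocallyOfFiniteType G.hom] [QuasiCompact G.hom]
    {L : Type u} [Field L] [Algebra k L]
    (Γ : AddSubgroup (FrobeniusScheme.Points G L)) (hfg : Γ.FG)
    (hF : ∀ x ∈ Γ, FrobeniusScheme.pointsFrobenius G L x ∈ Γ) :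
    ∃ r : ℕ, 0 < r ∧ ∃ S : Finset Γ,
      IsSpanningSet (FrobeniusScheme.restrictEnd (FrobeniusScheme.pointsFrobenius G L) Γ hF ^ r)
        S := by
  obtain ⟨S, hS⟩ := hfg
  obtain ⟨K, hK, hSK⟩ := exists_intermediateField_fg G (L := L)
    (S := Additive.ofMul ⁻¹' (S : Set (Points G L))) S.finite_toSet
  have : Algebra.EssFiniteType k K := IntermediateField.essFiniteType_iff.2 hK
  obtain ⟨h, hh⟩ := exists_isGroupHeight G K
  have hinj : Function.Injective (pointsMap G K.val) := fun x y hxy =>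
    specHom_comp_injective G K.val hxy
  have hΓ : Γ ≤ (pointsMap G K.val).range := by
    rw [← hS, AddSubgroup.closure_le]
    exact fun x hx => hSK x hx
  -- Injectivity of G(K) → G(L) makes this lift additive and Frobenius-equivariant, so the height on
  -- G(K) pulls back to Γ.
  choose e he using fun x : Γ => hΓ x.2
  have hadd (x y : Γ) : e (x + y) = e x + e y := hinj <| by rw [map_add, he, he, he]; rfl
  have : Module.Finite ℤ Γ := Module.Finite.iff_addGroup_fg.2
    ((AddGroup.fg_iff_addSubgroup_fg Γ).2 ⟨S, hS⟩)
  refine IsGroupHeight.exists_isSpanningSet (h := fun x => h (e x)) ⟨fun n => ?_, ?_, fun M => ?_⟩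
  · refine (hh.finite_le n).preimage (Function.Injective.injOn fun x y hxy => ?_)
    exact Subtype.ext (by rw [← he, ← he, hxy])
  · exact hh.add_le.imp fun C hC x y => by rw [hadd]; exact hC _ _
  · obtain ⟨r, hr, D, hD⟩ := hh.le_map M
    refine ⟨r, hr, D, fun x => ?_⟩
    have : e ((restrictEnd (pointsFrobenius G L) Γ hF ^ r) x) = (pointsFrobenius G K ^ r) (e x) :=
      hinj <| by rw [he, pointsMap_pointsFrobenius_pow, he, coe_restrictEnd_pow]
    rw [this]
    exact hD _
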